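/- Let $n\ge 2$, let $B^{2n}\subset\mathbb{C}^n$ be the open unit ball and $\rho=|x|$ the Euclidean distance from the origin. Let $\theta=\frac{i}{2}\sum_j(z^jd\bar z^j-\bar z^jdz^j)$ be the standard contact form of the unit sphere $S^{2n-1}$, and let $g_{\mathbb{C}P^{n-1}}$ be the Fubini--Study metric of $\mathbb{C}P^{n-1}$, normalized to have diameter $\pi/2$ and lifted to $S^{2n-1}$ by the Hopf map; both are pulled back to $\mathbb{C}^n\setminus\{0\}$ by $x\mapsto x/|x|$. For $c>0$ let $g_c$ be the smooth Poincaré--Einstein metric on $B^{2n}$ (with $\mathrm{Ric}(g_c)=-(2n-1)g_c$) given away from the origin by $$g_c=\frac{(r^2-1)^{n-1}}{P(r)}\,dr^2+\frac{c^2P(r)}{(r^2-1)^{n-1}}\,\theta^2+c(r^2-1)\,g_{\mathbb{C}P^{n-1}},\qquad r=1+\frac{2c^{-1}\rho^2}{1-\rho^2},$$ $$P(r)=r\int_1^r\left(2nc^{-1}t^{-2}(t^2-1)^{n-1}+(2n-1)t^{-2}(t^2-1)^n\right)dt,$$ and extended smoothly across the origin. Let $$g_{\mathbb{C}H^n}=2\left(\frac{d\rho^2+\rho^2\theta^2}{(1-\rho^2)^2}+\frac{\rho^2g_{\mathbb{C}P^{n-1}}}{1-\rho^2}\right)$$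 be the complex hyperbolic metric on $B^{2n}$, likewise extended smoothly across the origin. Then there are $\mathit{SU}(n)$-equivariant diffeomorphisms $\psi_c\colon\overline{B^{2n}}\to\overline{B^{2n}}$, $c>0$, smooth up to the boundary together with their inverses, such that, as $c\to\infty$, the pullbacks $\psi_c^*g_c$ converge to $\frac{n+1}{2n-1}\,g_{\mathbb{C}H^n}$ in the $C^\infty$ topology on every compact subset of $B^{2n}$; that is, all derivatives of the metric coefficients converge uniformly on every compact subset. -/

import Mathlib

open Filter Topology Metric
open scoped ContDiff

noncomputable section

namespace BergerBall

/-- `ℂⁿ` with its Euclidean norm, regarded as a real inner product space of dimension `2n`;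
the real inner product `inner ℝ x v` is the real part of the Hermitian product of `x` and `v`. -/
abbrev Cn (n : ℕ) : Type := EuclideanSpace ℂ (Fin n)

/-- Real bilinear forms on `ℂⁿ`. A metric on a subset of `ℂⁿ` is given, in the standard real
linear coordinates, by a function with values in this space. -/
abbrev BilinForm (n : ℕ) : Type := Cn n →L[ℝ] Cn n →L[ℝ] ℝ

/-- The Euclidean metric of `ℂⁿ`. -/
def euclid (n : ℕ) : BilinForm n := innerSL ℝ

theorem euclid_apply {n : ℕ} (v w : Cn n) : euclid n v w = inner ℝ v w := rfl

/-- The square `η² = η ⊗ η` of a covector. -/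
def sq {n : ℕ} (η : Cn n →L[ℝ] ℝ) : BilinForm n := η.smulRight η

/-- The differential `dρ` of the Euclidean distance `ρ` from the origin, at a point `x ≠ 0`:
`dρ(v) = Re ⟨x, v⟩ / |x|`. -/
def dRho {n : ℕ} (x : Cn n) : Cn n →L[ℝ] ℝ := ‖x‖⁻¹ • innerSL ℝ x

/-- The standard contact form `θ = (i/2) ∑ (zʲ d z̄ʲ - z̄ʲ d zʲ)` of the unit sphere, pulled back by
the radial projection `x ↦ z = x / |x|`, at a point `x ≠ 0`:
`θ(v) = Im ⟨x, v⟩ / |x|² = Re ⟨i x, v⟩ / |x|²`. -/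
def theta {n : ℕ} (x : Cn n) : Cn n →L[ℝ] ℝ := (‖x‖ ^ 2)⁻¹ • innerSL ℝ (Complex.I • x)

/-- The Fubini-Study metric of `ℂPⁿ⁻¹` (of diameter `π/2`), pulled back by the Hopf map
`x ↦ [x]`, at a point `x ≠ 0`: the Euclidean inner product of the components orthogonal to the
complex line through `x`, divided by `|x|²`. The real-orthonormal basis `x/|x|`, `i x/|x|` of that
line contributes `dρ²` and `(|x| θ)²` to the Euclidean metric. -/
def fubiniStudy {n : ℕ} (x : Cn n) : BilinForm n :=
  (‖x‖ ^ 2)⁻¹ • (euclid n - sq (dRho x) - ‖x‖ ^ 2 • sq (theta x))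

/-- The metric `A(ρ) dρ² + B(ρ) θ² + C(ρ) g_FS` away from the origin, with the value
`k` times the Euclidean metric at the origin. -/
def cohomOneMetric (n : ℕ) (k : ℝ) (A B C : ℝ → ℝ) (x : Cn n) : BilinForm n :=
  open Classical in
  if x = 0 then k • euclid n
  else A ‖x‖ • sq (dRho x) + B ‖x‖ • sq (theta x) + C ‖x‖ • fubiniStudy x

/-- The complex hyperbolic metric on the unit ball, with `Ric = -(n+1) g`:
`2 ((dρ² + ρ² θ²) / (1 - ρ²)² + ρ² g_FS / (1 - ρ²))`. -/
def gCH (n : ℕ) : Cn n → BilinForm n :=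
  cohomOneMetric n 2
    (fun ρ => 2 / (1 - ρ ^ 2) ^ 2)
    (fun ρ => 2 * ρ ^ 2 / (1 - ρ ^ 2) ^ 2)
    (fun ρ => 2 * ρ ^ 2 / (1 - ρ ^ 2))

/-- The polynomial `P = r ∫₁ʳ (λ c⁻¹ t⁻² (t² - 1)ⁿ⁻¹ - Λ t⁻² (t² - 1)ⁿ) dt` with `λ = 2n` and
`Λ = -(2n - 1)`, for `r ≥ 1`. -/
def P (n : ℕ) (c r : ℝ) : ℝ :=
  r * ∫ t in (1 : ℝ)..r,
    (2 * n * c⁻¹ * (t ^ 2)⁻¹ * (t ^ 2 - 1) ^ (n - 1)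
      + (2 * n - 1) * (t ^ 2)⁻¹ * (t ^ 2 - 1) ^ n)

/-- `α² = (r² - 1)ⁿ⁻¹ / P`. -/
def alphaSq (n : ℕ) (c r : ℝ) : ℝ := (r ^ 2 - 1) ^ (n - 1) / P n c r

/-- `β² = c² P / (r² - 1)ⁿ⁻¹`. -/
def betaSq (n : ℕ) (c r : ℝ) : ℝ := c ^ 2 * P n c r / (r ^ 2 - 1) ^ (n - 1)

/-- `γ² = c (r² - 1)`. -/
def gammaSq (c r : ℝ) : ℝ := c * (r ^ 2 - 1)

/-- The coordinate change `r = 1 + 2 c⁻¹ ρ² / (1 - ρ²)` between `0 < ρ < 1` and `1 < r`. -/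
def rOf (c ρ : ℝ) : ℝ := 1 + 2 * c⁻¹ * ρ ^ 2 / (1 - ρ ^ 2)

/-- The metric `g_c = α(r)² dr² + β(r)² θ² + γ(r)² g_FS` on the unit ball, `r` being the above
function of `ρ = |x|`. Its coefficients behave as `4 dρ² + 4 ρ² θ² + 4 ρ² g_FS` as `ρ → 0`, so that
its continuous extension to the origin is `4` times the Euclidean metric. -/
def g (n : ℕ) (c : ℝ) : Cn n → BilinForm n :=
  cohomOneMetric n 4
    (fun ρ => alphaSq n c (rOf c ρ) * deriv (rOf c) ρ ^ 2)
    (fun ρ => betaSq n c (rOf c ρ))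
    (fun ρ => gammaSq c (rOf c ρ))

/-- The linear action of a matrix on `ℂⁿ`. -/
def act {n : ℕ} (U : Matrix (Fin n) (Fin n) ℂ) (x : Cn n) : Cn n :=
  WithLp.toLp 2 (U.mulVec x.ofLp)

/-- `ψ` restricts to an `SU(n)`-equivariant diffeomorphism, smooth up to the boundary in both
directions, of the closed unit ball of `ℂⁿ` onto itself. -/
structure IsEquivariantDiffeo {n : ℕ} (ψ : Cn n → Cn n) : Prop where
  bijOn : Set.BijOn ψ (closedBall 0 1) (closedBall 0 1)
  smooth : ContDiffOn ℝ ∞ ψ (closedBall 0 1)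
  smooth_inv : ∃ φ : Cn n → Cn n, ContDiffOn ℝ ∞ φ (closedBall 0 1) ∧
    Set.InvOn φ ψ (closedBall 0 1) (closedBall 0 1)
  equivariant : ∀ U ∈ Matrix.specialUnitaryGroup (Fin n) ℂ, ∀ x ∈ closedBall (0 : Cn n) 1,
    ψ (act U x) = act U (ψ x)

/-- The pullback `ψ^* h`. -/
def pullback {n : ℕ} (ψ : Cn n → Cn n) (h : Cn n → BilinForm n) (x : Cn n) : BilinForm n :=
  (h (ψ x)).bilinearComp (fderiv ℝ ψ x) (fderiv ℝ ψ x)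

/-- As `c → ∞`, the metrics `h c` converge to `h∞` in the `C^∞` topology on every compact subset
of the open set `U`: they are smooth on `U` for large `c`, `h∞` is smooth on `U`, and all derivatives
of the coefficients converge uniformly on every compact subset of `U`. -/
structure SmoothlyConvergesOn {n : ℕ} (h : ℝ → Cn n → BilinForm n) (hinf : Cn n → BilinForm n)
    (U : Set (Cn n)) : Prop where
  smooth : ∀ᶠ c in atTop, ContDiffOn ℝ ∞ (h c) U
  smooth_limit : ContDiffOn ℝ ∞ hinf U
  tendsto : ∀ K ⊆ U, IsCompact K → ∀ m : ℕ,
    TendstoUniformlyOn (fun c => iteratedFDeriv ℝ m (h c)) (iteratedFDeriv ℝ m hinf) atTop K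

end BergerBall

end

/-! Put `ε = c⁻¹`, `t = |x|²`, `u = t / (1 - t)`, so that `r - 1 = 2uε`. Integration by parts gives
`P = ε (r - 1)ⁿ q(ε, u)` with `q` a polynomial, positive for `ε, u ≥ 0` (`P_eq`, `qFun_pos`). The
powers of `r - 1` cancel from `α²` and `β²`, and in the forms `Re⟨x,·⟩²`, `Im⟨x,·⟩²`, `|·|²` the
coefficients of `g_c` are smooth functions of `(ε, t)`, also at `t = 0` and at `ε = 0`
(`g_eq_radialForm`). The limit `c → ∞` is thus evaluation of a smooth family at `ε = 0`, and
convergence of all derivatives on compact sets is automatic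
(`tendstoUniformlyOn_iteratedFDeriv_slice`).

It remains to identify the limit. At `ε = 0`, `q = 2ⁿ(1 + ku)` with `k = 2(2n-1)/(n+1)`. The map
`dilate k` replaces `u` by `u/k`, which turns `q` into `2ⁿ/(1 - t)` and the limit into `2/k =
(n+1)/(2n-1)` times the complex hyperbolic metric (`pullbackFamily_zero`). One dilation serves for
every `c`. -/

noncomputable section

namespace BergerBall

/-! ### Closed form of the integral defining `P` -/

section Polynomials

open Polynomial

/-- The polynomial with `sⁿ⁺¹ K(s) = ∫₀ˢ (t (2 + t))ⁿ dt`. -/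
def kPoly (n : ℕ) : ℝ[X] :=
  ∑ k ∈ Finset.range (n + 1), C (2 ^ (n - k) * (n.choose k : ℝ) / (n + k + 1)) * X ^ k

theorem hasDerivAt_kPoly (n : ℕ) (s : ℝ) :
    HasDerivAt (fun s => s ^ (n + 1) * (kPoly n).eval s) ((s * (2 + s)) ^ n) s := by
  have h1 : (fun s : ℝ => s ^ (n + 1) * (kPoly n).eval s) = fun s =>
      ∑ k ∈ Finset.range (n + 1), 2 ^ (n - k) * (n.choose k : ℝ) / (n + k + 1) * s ^ (n + k + 1) := by
    funext s
    simp only [kPoly, eval_finsetSum, eval_mul, eval_C, eval_pow, eval_X, Finset.mul_sum]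
    refine Finset.sum_congr rfl fun k _ => ?_
    ring
  have h2 : (s * (2 + s)) ^ n = ∑ k ∈ Finset.range (n + 1),
      2 ^ (n - k) * (n.choose k : ℝ) / (n + k + 1) * (((n + k + 1 : ℕ) : ℝ) * s ^ (n + k)) := by
    rw [mul_pow, add_comm 2 s, add_pow, Finset.mul_sum]
    refine Finset.sum_congr rfl fun k _ => ?_
    have : (n + k + 1 : ℝ) ≠ 0 := by positivity
    push_cast
    field_simp
    ring
  rw [h1, h2]
  refine HasDerivAt.fun_sum fun k _ => ?_
  simpa using (hasDerivAt_pow (n + k + 1) s).const_mul (2 ^ (n - k) * (n.choose k : ℝ) / (n + k + 1))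

theorem eval_zero_kPoly (n : ℕ) : (kPoly n).eval 0 = 2 ^ n / (n + 1) := by
  simp only [kPoly, eval_finsetSum, eval_mul, eval_C, eval_pow, eval_X]
  rw [Finset.sum_eq_single 0] <;> simp +contextual

/-- The polynomial with `r ∫₁ʳ t⁻² (t² - 1)ⁿ dt = (r - 1)ⁿ⁺¹ R(r - 1)`. -/
def rPoly (n : ℕ) : ℝ[X] := (C 2 + X) ^ (n + 1) - C (2 * n + 1 : ℝ) * (1 + X) * kPoly n

theorem eval_rPoly (n : ℕ) (s : ℝ) :
    (rPoly n).eval s = (2 + s) ^ (n + 1) - (2 * n + 1) * (1 + s) * (kPoly n).eval s := by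
  simp [rPoly]

theorem eval_zero_rPoly (n : ℕ) : (rPoly n).eval 0 = 2 ^ n / (n + 1) := by
  have : (n + 1 : ℝ) ≠ 0 := by positivity
  rw [eval_rPoly, eval_zero_kPoly]
  field_simp
  ring

theorem continuousOn_integrand (n : ℕ) {r : ℝ} (hr : 1 ≤ r) :
    ContinuousOn (fun t : ℝ => (t ^ 2)⁻¹ * (t ^ 2 - 1) ^ n) (Set.uIcc 1 r) := by
  refine ContinuousOn.mul (ContinuousOn.inv₀ (by fun_prop) fun t ht => ?_) (by fun_prop)
  rw [Set.uIcc_of_le hr] at ht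
  have : 0 < t := by linarith [ht.1]
  positivity

/-- The derivative of `(t² - 1)ⁿ⁺¹ / t` is `(2n + 1)(t² - 1)ⁿ + t⁻²(t² - 1)ⁿ`, and with `t = 1 + s`
one has `t² - 1 = s(2 + s)`, so the first term is integrated by `hasDerivAt_kPoly`. -/
theorem integral_eq_rPoly (n : ℕ) {r : ℝ} (hr : 1 ≤ r) :
    r * ∫ t in (1 : ℝ)..r, (t ^ 2)⁻¹ * (t ^ 2 - 1) ^ n
      = (r - 1) ^ (n + 1) * (rPoly n).eval (r - 1) := by
  have hd : ∀ t ∈ Set.uIcc 1 r, HasDerivAt (fun t : ℝ => (t ^ 2 - 1) ^ (n + 1) * t⁻¹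
      - (2 * n + 1) * ((t - 1) ^ (n + 1) * (kPoly n).eval (t - 1)))
      ((t ^ 2)⁻¹ * (t ^ 2 - 1) ^ n) t := by
    intro t ht
    rw [Set.uIcc_of_le hr] at ht
    have ht0 : t ≠ 0 := by linarith [ht.1]
    have h1 := (((hasDerivAt_pow 2 t).sub_const 1).pow (n + 1)).mul (hasDerivAt_inv ht0)
    have h2 := ((hasDerivAt_kPoly n (t - 1)).comp t ((hasDerivAt_id t).sub_const 1)).const_mul
      (2 * n + 1 : ℝ)
    refine (h1.sub h2).congr_deriv ?_
    have : (t - 1) * (2 + (t - 1)) = t ^ 2 - 1 := by ring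
    rw [this]
    simp only [Nat.add_sub_cancel, Nat.cast_add, Nat.cast_one, Nat.cast_ofNat, Pi.pow_apply]
    field_simp
    ring
  rw [intervalIntegral.integral_eq_sub_of_hasDerivAt hd
    (continuousOn_integrand n hr).intervalIntegrable, eval_rPoly]
  have hr0 : r ≠ 0 := by linarith
  have h1 : r ^ 2 - 1 = (r - 1) * (2 + (r - 1)) := by ring
  rw [h1, mul_pow]
  simp
  field_simp

theorem eval_rPoly_pos (n : ℕ) {s : ℝ} (hs : 0 ≤ s) : 0 < (rPoly n).eval s := by
  rcases hs.eq_or_lt with rfl | hs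
  · rw [eval_zero_rPoly]; positivity
  · have h := integral_eq_rPoly n (r := 1 + s) (by linarith)
    rw [add_sub_cancel_left] at h
    have hpos : 0 < ∫ t in (1 : ℝ)..(1 + s), (t ^ 2)⁻¹ * (t ^ 2 - 1) ^ n := by
      refine intervalIntegral.intervalIntegral_pos_of_pos_on
        (continuousOn_integrand n (by linarith)).intervalIntegrable (fun t ht => ?_) (by linarith)
      have h0 : 1 < t := ht.1
      have h1 : 0 < t ^ 2 - 1 := by nlinarith
      positivity
    have : 0 < s ^ (n + 1) * (rPoly n).eval s := h ▸ mul_pos (by linarith) hpos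
    exact pos_of_mul_pos_right this (by positivity)

/-- The quotient of `2n Rₙ₋₁(s) - (2 + s)ⁿ` by `s`. -/
def tPoly (n : ℕ) : ℝ[X] := (C (2 * n : ℝ) * rPoly (n - 1) - (C 2 + X) ^ n).divX

/-- The constant terms agree because `Rₙ₋₁(0) = 2ⁿ⁻¹/n`. This divisibility is what makes the metric
smooth at the origin. -/
theorem eval_tPoly {n : ℕ} (hn : 1 ≤ n) (s : ℝ) :
    2 * n * (rPoly (n - 1)).eval s = (2 + s) ^ n + s * (tPoly n).eval s := by
  have h := congrArg (eval s) (X_mul_divX_add (C (2 * n : ℝ) * rPoly (n - 1) - (C 2 + X) ^ n))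
  have h0 : (C (2 * n : ℝ) * rPoly (n - 1) - (C 2 + X) ^ n).coeff 0 = 0 := by
    have hn' : (n : ℝ) ≠ 0 := by positivity
    obtain ⟨m, rfl⟩ : ∃ m, n = m + 1 := ⟨n - 1, by omega⟩
    rw [coeff_zero_eq_eval_zero]
    simp only [Nat.add_sub_cancel, eval_sub, eval_mul, eval_C, eval_zero_rPoly, eval_pow, eval_add,
      eval_X]
    push_cast at hn' ⊢
    field_simp
    ring
  rw [h0] at h
  simp at h
  rw [tPoly]
  simp
  linarith

end Polynomials

/-! ### Smooth dependence on a parameter implies `C^∞` convergence on compact sets -/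

section Parametric

variable {E F : Type*} [NormedAddCommGroup E] [NormedSpace ℝ E]
  [NormedAddCommGroup F] [NormedSpace ℝ F]

/-- The slice is a translate of `f` composed with the linear inclusion of `E`, so the chain rule for
linear maps applies. -/
theorem iteratedFDeriv_slice {f : ℝ × E → F} {m : ℕ} {a : ℝ} {x : E}
    (hf : ContDiffAt ℝ m f (a, x)) :
    iteratedFDeriv ℝ m (fun y => f (a, y)) x
      = (iteratedFDeriv ℝ m f (a, x)).compContinuousLinearMap
          fun _ => ContinuousLinearMap.inr ℝ ℝ E := by
  set h : ℝ × E → F := fun p => f ((a, 0) + p) with hh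
  have hh1 : ContDiffAt ℝ m h (0, x) := by
    refine ContDiffAt.comp (g := f) (f := fun p => (a, 0) + p) (0, x) (by simpa using hf) ?_
    fun_prop
  obtain ⟨W, hW, hxW, hWc⟩ : ∃ W : Set (ℝ × E), IsOpen W ∧ (0, x) ∈ W ∧ ContDiffOn ℝ m h W := by
    obtain ⟨u, hu, hc⟩ := hh1.contDiffOn le_rfl (by simp)
    obtain ⟨W, hWu, hWo, hxW⟩ := _root_.mem_nhds_iff.1 hu
    exact ⟨W, hWo, hxW, hc.mono hWu⟩
  have hpre : IsOpen (ContinuousLinearMap.inr ℝ ℝ E ⁻¹' W) :=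
    hW.preimage (ContinuousLinearMap.inr ℝ ℝ E).continuous
  have hx' : ContinuousLinearMap.inr ℝ ℝ E x ∈ W := by simpa using hxW
  have key := (ContinuousLinearMap.inr ℝ ℝ E).iteratedFDerivWithin_comp_right hWc
    hW.uniqueDiffOn hpre.uniqueDiffOn hx' le_rfl
  rw [iteratedFDerivWithin_of_isOpen _ hpre hx', iteratedFDerivWithin_of_isOpen _ hW hx'] at key
  have h1 : h ∘ ContinuousLinearMap.inr ℝ ℝ E = fun y => f (a, y) := by
    funext y; simp [hh]
  rw [h1] at key
  rw [key, hh, iteratedFDeriv_comp_add_left]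
  simp

/-- The derivatives in `y` alone are jointly continuous at each `(0, x)`; this gives locally uniform
convergence on `K`, hence uniform convergence by compactness. -/
theorem tendstoUniformlyOn_iteratedFDeriv_slice {f : ℝ × E → F} {K : Set E} (hK : IsCompact K)
    (hf : ∀ x ∈ K, ContDiffAt ℝ ∞ f (0, x)) (m : ℕ) :
    TendstoUniformlyOn (fun a => iteratedFDeriv ℝ m fun y => f (a, y))
      (iteratedFDeriv ℝ m fun y => f (0, y)) (𝓝 0) K := by
  set Φ : ℝ × E → _ := fun p => iteratedFDeriv ℝ m (fun y => f (p.1, y)) p.2 with hΦ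
  have hc : ∀ x ∈ K, ContinuousAt Φ (0, x) := by
    intro x hx
    have hm : ContDiffAt ℝ m f (0, x) := (hf x hx).of_le (by exact_mod_cast le_top)
    have hev : Φ =ᶠ[𝓝 (0, x)] fun p => (iteratedFDeriv ℝ m f p).compContinuousLinearMap
        fun _ => ContinuousLinearMap.inr ℝ ℝ E := by
      filter_upwards [hm.eventually (by simp)] with p hp
      exact iteratedFDeriv_slice hp
    refine ContinuousAt.congr ?_ hev.symm
    exact (ContinuousMultilinearMap.compContinuousLinearMapL (F := F)
      (fun _ : Fin m => ContinuousLinearMap.inr ℝ ℝ E)).continuous.continuousAt.comp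
        (hm.continuousAt_iteratedFDeriv le_rfl)
  rw [← tendstoLocallyUniformlyOn_iff_tendstoUniformlyOn_of_compact hK,
    tendstoLocallyUniformlyOn_iff_forall_tendsto]
  intro x hx
  have h1 : Tendsto Φ (𝓝 0 ×ˢ 𝓝[K] x) (𝓝 (Φ (0, x))) :=
    (hc x hx).tendsto.mono_left (by rw [nhds_prod_eq]; gcongr; exact nhdsWithin_le_nhds)
  have h2 : Tendsto (fun p : ℝ × E => Φ (0, p.2)) (𝓝 0 ×ˢ 𝓝[K] x) (𝓝 (Φ (0, x))) := by
    refine (hc x hx).tendsto.comp ?_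
    rw [nhds_prod_eq]
    exact tendsto_const_nhds.prodMk (tendsto_snd.mono_right nhdsWithin_le_nhds)
  refine (h2.prodMk_nhds h1).mono_right ?_
  exact nhds_le_uniformity (Φ (0, x))

end Parametric

/-! ### Radial forms and cohomogeneity-one metrics -/

variable {n : ℕ}

/-- The form `p Re⟨x, ·⟩² + q Im⟨x, ·⟩² + e |·|²`. -/
def radialForm (p q e : ℝ) (x : Cn n) : BilinForm n :=
  p • sq (innerSL ℝ x) + q • sq (innerSL ℝ (Complex.I • x)) + e • euclid n

theorem radialForm_apply (p q e : ℝ) (x v w : Cn n) :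
    radialForm p q e x v w = p * (inner ℝ x v * inner ℝ x w)
      + q * (inner ℝ (Complex.I • x) v * inner ℝ (Complex.I • x) w) + e * inner ℝ v w := by
  simp [radialForm, sq, euclid_apply]

theorem inner_I_smul_self (x : Cn n) : inner ℝ (Complex.I • x) x = 0 := by
  have h : ∀ y : Cn n, inner ℝ y x = (inner ℂ y x).re := fun y => by simp [PiLp.inner_apply]
  rw [h, inner_smul_left, inner_self_eq_norm_sq_to_K]
  simp [← Complex.ofReal_pow]

theorem contDiffAt_sum_sq {E H : Type*} [NormedAddCommGroup E] [NormedSpace ℝ E]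
    [NormedAddCommGroup H] [NormedSpace ℝ H] (B : H →L[ℝ] H →L[ℝ] ℝ) {p q e : E → ℝ} {f g : E → H}
    {a : E} (hp : ContDiffAt ℝ ∞ p a) (hq : ContDiffAt ℝ ∞ q a) (he : ContDiffAt ℝ ∞ e a)
    (hf : ContDiffAt ℝ ∞ f a) (hg : ContDiffAt ℝ ∞ g a) :
    ContDiffAt ℝ ∞ (fun y => p y • (B (f y)).smulRight (B (f y))
      + q y • (B (g y)).smulRight (B (g y)) + e y • B) a := by
  have hf' := B.contDiff.contDiffAt.comp a hf
  have hg' := B.contDiff.contDiffAt.comp a hg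
  exact ((hp.smul (hf'.smulRight hf')).add (hq.smul (hg'.smulRight hg'))).add
    (he.smul contDiffAt_const)

theorem contDiffAt_radialForm {E : Type*} [NormedAddCommGroup E] [NormedSpace ℝ E]
    {p q e : E → ℝ} {f : E → Cn n} {a : E} (hp : ContDiffAt ℝ ∞ p a) (hq : ContDiffAt ℝ ∞ q a)
    (he : ContDiffAt ℝ ∞ e a) (hf : ContDiffAt ℝ ∞ f a) :
    ContDiffAt ℝ ∞ (fun y => radialForm (p y) (q y) (e y) (f y)) a :=
  contDiffAt_sum_sq (euclid n) hp hq he hf (hf.const_smul Complex.I)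

theorem smul_radialForm (k p q e : ℝ) (x : Cn n) :
    k • radialForm p q e x = radialForm (k * p) (k * q) (k * e) x := by
  ext v w
  have h : (k • radialForm p q e x) v w = k * radialForm p q e x v w := rfl
  rw [h, radialForm_apply, radialForm_apply]
  ring

/-- Smoothness across the origin now amounts to cancelling the powers of `‖x‖` in these
denominators. -/
theorem cohomOneMetric_eq_radialForm {k : ℝ} {A B C : ℝ → ℝ} {x : Cn n} (hx : x ≠ 0) :
    cohomOneMetric n k A B C x =
      radialForm ((A ‖x‖ - C ‖x‖ / ‖x‖ ^ 2) / ‖x‖ ^ 2) ((B ‖x‖ - C ‖x‖) / ‖x‖ ^ 4)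
        (C ‖x‖ / ‖x‖ ^ 2) x := by
  have hx' : ‖x‖ ≠ 0 := norm_ne_zero_iff.2 hx
  ext v w
  rw [radialForm_apply, cohomOneMetric, if_neg hx]
  simp only [fubiniStudy, sq, dRho, theta, add_apply, sub_apply, smul_apply,
    ContinuousLinearMap.smulRight_apply, innerSL_apply_apply, euclid_apply, smul_eq_mul]
  field_simp
  ring

/-- The first two terms vanish at the origin, so `p` and `q` are free and can be matched to the
formulas valid for `x ≠ 0`. -/
theorem cohomOneMetric_zero {k : ℝ} {A B C : ℝ → ℝ} (p q : ℝ) :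
    cohomOneMetric n k A B C 0 = radialForm p q k 0 := by
  ext v w
  have h : (k • euclid n) v w = k * inner ℝ v w := rfl
  rw [cohomOneMetric, if_pos rfl, radialForm_apply, h]
  simp

theorem gCH_eq_radialForm {x : Cn n} (hx : ‖x‖ < 1) :
    gCH n x = radialForm (2 / (1 - ‖x‖ ^ 2) ^ 2) (2 / (1 - ‖x‖ ^ 2) ^ 2)
      (2 / (1 - ‖x‖ ^ 2)) x := by
  by_cases h0 : x = 0
  · subst h0
    rw [gCH, cohomOneMetric_zero 2 2]
    simp
  · have hx' : ‖x‖ ≠ 0 := norm_ne_zero_iff.2 h0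
    have h1 : 1 - ‖x‖ ^ 2 ≠ 0 := by nlinarith [norm_nonneg x]
    rw [gCH, cohomOneMetric_eq_radialForm h0]
    congr 1 <;> field_simp <;> ring

/-! ### Equivariant dilations of the ball -/

/-- The map `x ↦ x / √(k + (1 - k) |x|²)`, which multiplies `|x|² / (1 - |x|²)` by `k⁻¹`. -/
def dilate (k : ℝ) (x : Cn n) : Cn n := (√(k + (1 - k) * ‖x‖ ^ 2))⁻¹ • x

theorem dilate_den_pos {k : ℝ} (hk : 0 < k) {x : Cn n} (hx : ‖x‖ ≤ 1) :
    0 < k + (1 - k) * ‖x‖ ^ 2 := by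
  have : ‖x‖ ^ 2 ≤ 1 := by nlinarith [norm_nonneg x]
  rcases le_total k 1 with h | h
  · nlinarith [sq_nonneg ‖x‖]
  · nlinarith [sq_nonneg ‖x‖]

theorem norm_dilate_sq {k : ℝ} (hk : 0 < k) {x : Cn n} (hx : ‖x‖ ≤ 1) :
    ‖dilate k x‖ ^ 2 = ‖x‖ ^ 2 / (k + (1 - k) * ‖x‖ ^ 2) := by
  rw [dilate, norm_smul, mul_pow, Real.norm_eq_abs, sq_abs, inv_pow,
    Real.sq_sqrt (dilate_den_pos hk hx).le]
  ring

theorem norm_dilate_le {k : ℝ} (hk : 0 < k) {x : Cn n} (hx : ‖x‖ ≤ 1) : ‖dilate k x‖ ≤ 1 := by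
  have h : ‖dilate k x‖ ^ 2 ≤ 1 := by
    rw [norm_dilate_sq hk hx, div_le_one (dilate_den_pos hk hx)]
    have : ‖x‖ ^ 2 ≤ 1 := by nlinarith [norm_nonneg x]
    nlinarith
  nlinarith [norm_nonneg (dilate k x)]

theorem norm_dilate_lt {k : ℝ} (hk : 0 < k) {x : Cn n} (hx : ‖x‖ < 1) : ‖dilate k x‖ < 1 := by
  have h : ‖dilate k x‖ ^ 2 < 1 := by
    rw [norm_dilate_sq hk hx.le, div_lt_one (dilate_den_pos hk hx.le)]
    have : ‖x‖ ^ 2 < 1 := by nlinarith [norm_nonneg x]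
    nlinarith
  nlinarith [norm_nonneg (dilate k x)]

theorem dilate_inv_dilate {k : ℝ} (hk : 0 < k) {x : Cn n} (hx : ‖x‖ ≤ 1) :
    dilate k⁻¹ (dilate k x) = x := by
  have hD := dilate_den_pos hk hx
  have h : k⁻¹ + (1 - k⁻¹) * ‖dilate k x‖ ^ 2 = (k + (1 - k) * ‖x‖ ^ 2)⁻¹ := by
    rw [norm_dilate_sq hk hx]
    have h0 := hD.ne'
    generalize hDt : k + (1 - k) * ‖x‖ ^ 2 = D at *
    field_simp
    linear_combination -hDt
  rw [dilate, h, dilate, smul_smul, Real.sqrt_inv, inv_inv, mul_inv_cancel₀, one_smul]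
  exact (Real.sqrt_pos.2 hD).ne'

theorem contDiffAt_dilate {k : ℝ} (hk : 0 < k) {x : Cn n} (hx : ‖x‖ ≤ 1) :
    ContDiffAt ℝ ∞ (dilate k) x := by
  have hD := dilate_den_pos hk hx
  have h1 : ContDiffAt ℝ ∞ (fun x : Cn n => k + (1 - k) * ‖x‖ ^ 2) x :=
    (contDiff_const.add (contDiff_const.mul (contDiff_norm_sq ℝ))).contDiffAt
  exact ((h1.sqrt hD.ne').inv (Real.sqrt_pos.2 hD).ne').smul contDiffAt_id

theorem isEquivariantDiffeo_dilate {k : ℝ} (hk : 0 < k) :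
    IsEquivariantDiffeo (dilate k : Cn n → Cn n) := by
  have hmaps : ∀ {k : ℝ}, 0 < k →
      Set.MapsTo (dilate k : Cn n → Cn n) (closedBall 0 1) (closedBall 0 1) := by
    intro k hk x hx
    rw [mem_closedBall_zero_iff] at hx ⊢
    exact norm_dilate_le hk hx
  have hinv : Set.InvOn (dilate k⁻¹ : Cn n → Cn n) (dilate k) (closedBall 0 1) (closedBall 0 1) := by
    constructor
    · intro x hx
      exact dilate_inv_dilate hk (mem_closedBall_zero_iff.1 hx)
    · intro x hx
      simpa using dilate_inv_dilate (inv_pos.2 hk) (mem_closedBall_zero_iff.1 hx)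
  refine ⟨hinv.bijOn (hmaps hk) (hmaps (inv_pos.2 hk)), fun x hx => ?_,
    ⟨dilate k⁻¹, fun x hx => ?_, hinv⟩, fun U hU x hx => ?_⟩
  · exact (contDiffAt_dilate hk (mem_closedBall_zero_iff.1 hx)).contDiffWithinAt
  · exact (contDiffAt_dilate (inv_pos.2 hk) (mem_closedBall_zero_iff.1 hx)).contDiffWithinAt
  -- The scaling factor of `dilate` depends only on the norm, so equivariance reduces to unitary
  -- invariance of the norm.
  · have hn : ‖act U x‖ = ‖x‖ := by
      have hU' := (Matrix.mem_specialUnitaryGroup_iff.1 hU).1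
      rw [Matrix.mem_unitaryGroup_iff', Matrix.star_eq_conjTranspose] at hU'
      rw [norm_eq_sqrt_re_inner (𝕜 := ℂ), norm_eq_sqrt_re_inner (𝕜 := ℂ) x,
        EuclideanSpace.inner_eq_star_dotProduct, EuclideanSpace.inner_eq_star_dotProduct]
      simp only [act]
      rw [Matrix.star_mulVec, dotProduct_comm, ← Matrix.dotProduct_mulVec, Matrix.mulVec_mulVec,
        hU', Matrix.one_mulVec, dotProduct_comm]
    rw [dilate, hn, dilate]
    ext i
    simp [act, Matrix.mulVec_smul]

theorem fderiv_dilate {k : ℝ} (hk : 0 < k) {x : Cn n} (hx : ‖x‖ ≤ 1) (v : Cn n) :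
    fderiv ℝ (dilate k) x v = (√(k + (1 - k) * ‖x‖ ^ 2))⁻¹ •
      (v - ((1 - k) / (k + (1 - k) * ‖x‖ ^ 2) * inner ℝ x v) • x) := by
  have hD := dilate_den_pos hk hx
  have hs := Real.sqrt_pos.2 hD
  have h1 : HasFDerivAt (fun x : Cn n => k + (1 - k) * ‖x‖ ^ 2) ((1 - k) • 2 • innerSL ℝ x) x := by
    have := (((hasStrictFDerivAt_norm_sq x).hasFDerivAt).const_mul (1 - k)).const_add k
    simpa using this
  have h2 := ((hasDerivAt_inv hs.ne').comp_hasFDerivAt x (h1.sqrt hD.ne')).smul (hasFDerivAt_id x)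
  have h3 : HasFDerivAt (dilate k : Cn n → Cn n) _ x := h2
  rw [h3.fderiv]
  have hss := Real.sq_sqrt hD.le
  simp only [Function.comp_apply, add_apply, smul_apply, ContinuousLinearMap.id_apply,
    ContinuousLinearMap.smulRight_apply, innerSL_apply_apply, smul_eq_mul, nsmul_eq_mul, hss,
    smul_sub, smul_smul, id_eq]
  rw [sub_eq_add_neg (_ • v), ← neg_smul]
  congr 2
  push_cast
  field_simp

/-- The derivative rescales `v` and corrects it by a multiple of `x`. The correction is invisible to
`Im⟨x,·⟩` because `ix ⟂ x`, changes the factor on `Re⟨x,·⟩` to `k/D²`, and adds a radial term to the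
Euclidean form. -/
theorem pullback_dilate {k : ℝ} (hk : 0 < k) {h : Cn n → BilinForm n} {x : Cn n} (hx : ‖x‖ ≤ 1)
    {p q e D : ℝ} (hD : D = k + (1 - k) * ‖x‖ ^ 2)
    (hh : h (dilate k x) = radialForm p q e (dilate k x)) :
    pullback (dilate k) h x = radialForm
      (p * k ^ 2 / D ^ 4 + e / D * ((1 - k) ^ 2 * ‖x‖ ^ 2 / D ^ 2 - 2 * (1 - k) / D))
      (q / D ^ 2) (e / D) x := by
  have hDp : 0 < D := hD ▸ dilate_den_pos hk hx
  have hs := Real.sqrt_pos.2 hDp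
  have hss : √D * √D = D := Real.mul_self_sqrt hDp.le
  have hI := inner_I_smul_self x
  set t := ‖x‖ ^ 2 with ht
  have hl : (√D)⁻¹ * (√D)⁻¹ = D⁻¹ := by rw [← mul_inv, hss]
  have hd : ∀ v, fderiv ℝ (dilate k) x v = (√D)⁻¹ • (v - ((1 - k) / D * inner ℝ x v) • x) := by
    intro v
    rw [fderiv_dilate hk hx, ← ht, ← hD]
  have h1 : ∀ v, inner ℝ (dilate k x) (fderiv ℝ (dilate k) x v) = k / D ^ 2 * inner ℝ x v := by
    intro v
    rw [hd, dilate, ← ht, ← hD, real_inner_smul_left, real_inner_smul_right, ← mul_assoc, hl,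
      inner_sub_right, real_inner_smul_right, real_inner_self_eq_norm_sq, ← ht]
    field_simp
    linear_combination inner ℝ x v * hD
  have h2 : ∀ v, inner ℝ (Complex.I • dilate k x) (fderiv ℝ (dilate k) x v)
      = D⁻¹ * inner ℝ (Complex.I • x) v := by
    intro v
    rw [hd, dilate, ← ht, ← hD, smul_comm Complex.I, real_inner_smul_left, real_inner_smul_right,
      ← mul_assoc, hl, inner_sub_right, real_inner_smul_right, hI]
    ring
  have h3 : ∀ v w, inner ℝ (fderiv ℝ (dilate k) x v) (fderiv ℝ (dilate k) x w)
      = D⁻¹ * (inner ℝ v w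
        + ((1 - k) ^ 2 * t / D ^ 2 - 2 * (1 - k) / D) * (inner ℝ x v * inner ℝ x w)) := by
    intro v w
    rw [hd, hd, real_inner_smul_left, real_inner_smul_right, ← mul_assoc, hl]
    simp only [inner_sub_left, inner_sub_right, real_inner_smul_left, real_inner_smul_right,
      real_inner_self_eq_norm_sq, ← ht]
    rw [real_inner_comm x v]
    ring
  ext v w
  rw [pullback, hh, ContinuousLinearMap.bilinearComp_apply, radialForm_apply, radialForm_apply,
    h1, h1, h2, h2, h3]
  field_simp
  ring

/-! ### The coefficients of `g_c` as functions of `ε` and `|x|²` -/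

/-- The polynomial `q` with `P = c⁻¹ (r - 1)ⁿ q`, in terms of `ε = c⁻¹` and `u = c (r - 1) / 2`. -/
def qFun (n : ℕ) (ε u : ℝ) : ℝ :=
  2 * n * (rPoly (n - 1)).eval (2 * u * ε) + (2 * n - 1) * (2 * u) * (rPoly n).eval (2 * u * ε)

/-- The quotient of `q - (2 + s)ⁿ` by `u`, where `s = 2 u ε`. -/
def vFun (n : ℕ) (ε u : ℝ) : ℝ :=
  2 * ε * (tPoly n).eval (2 * u * ε) + 2 * (2 * n - 1) * (rPoly n).eval (2 * u * ε)

theorem qFun_eq (hn : 1 ≤ n) (ε u : ℝ) :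
    qFun n ε u = (2 + 2 * u * ε) ^ n + u * vFun n ε u := by
  rw [qFun, vFun, eval_tPoly hn]
  ring

theorem qFun_pos (hn : 1 ≤ n) {ε u : ℝ} (hε : 0 ≤ ε) (hu : 0 ≤ u) : 0 < qFun n ε u := by
  have h1 := eval_rPoly_pos (n - 1) (s := 2 * u * ε) (by positivity)
  have h2 := eval_rPoly_pos n (s := 2 * u * ε) (by positivity)
  have hn' : (1 : ℝ) ≤ n := by exact_mod_cast hn
  have h3 : (0 : ℝ) ≤ 2 * n - 1 := by linarith
  unfold qFun
  positivity

/-- The second integral carries one more factor `r - 1 = 2uε` than the first, which supplies the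
`c⁻¹` that the first has as a coefficient. -/
theorem P_eq (hn : 1 ≤ n) {c u : ℝ} (hc : 0 < c) (hu : 0 ≤ u) :
    P n c (1 + 2 * u * c⁻¹) = c⁻¹ * (2 * u * c⁻¹) ^ n * qFun n c⁻¹ u := by
  have hr : 1 ≤ 1 + 2 * u * c⁻¹ := by
    have : 0 ≤ 2 * u * c⁻¹ := by positivity
    linarith
  have h1 := integral_eq_rPoly (n - 1) hr
  have h2 := integral_eq_rPoly n hr
  have hi : ∀ m : ℕ, IntervalIntegrable (fun t : ℝ => (t ^ 2)⁻¹ * (t ^ 2 - 1) ^ m)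
      MeasureTheory.volume 1 (1 + 2 * u * c⁻¹) :=
    fun m => (continuousOn_integrand m hr).intervalIntegrable
  rw [Nat.sub_add_cancel hn] at h1
  rw [add_sub_cancel_left] at h1 h2
  rw [P]
  simp_rw [mul_assoc (2 * (n : ℝ) * c⁻¹), mul_assoc (2 * (n : ℝ) - 1)]
  rw [intervalIntegral.integral_add ((hi _).const_mul _) ((hi _).const_mul _),
    intervalIntegral.integral_const_mul, intervalIntegral.integral_const_mul, qFun]
  linear_combination 2 * n * c⁻¹ * h1 + (2 * n - 1) * h2

/-- The coefficient of `Re⟨x, ·⟩²` in `g`, as a function of `ε = c⁻¹` and `t = |x|²`. -/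
def gRe (n : ℕ) (ε t : ℝ) : ℝ :=
  (4 * (2 + 2 * (t / (1 - t)) * ε) ^ (n - 1) * (1 - ε) * (4 + 2 * (t / (1 - t))
    + 2 * (t / (1 - t)) * ε) - 2 * (2 + 2 * (t / (1 - t)) * ε) * vFun n ε (t / (1 - t)))
    / ((1 - t) ^ 2 * qFun n ε (t / (1 - t)))

/-- The coefficient of `Im⟨x, ·⟩²` in `g`, as a function of `ε = c⁻¹` and `t = |x|²`. -/
def gIm (n : ℕ) (ε t : ℝ) : ℝ :=
  2 * vFun n ε (t / (1 - t)) / ((1 - t) ^ 2 * (2 + 2 * (t / (1 - t)) * ε) ^ (n - 1))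

/-- The coefficient of `|·|²` in `g`, as a function of `ε = c⁻¹` and `t = |x|²`. -/
def gEuclid (ε t : ℝ) : ℝ := 2 * (2 + 2 * (t / (1 - t)) * ε) / (1 - t)

theorem deriv_rOf {c ρ : ℝ} (hρ : 1 - ρ ^ 2 ≠ 0) :
    deriv (rOf c) ρ = 4 * c⁻¹ * ρ / (1 - ρ ^ 2) ^ 2 := by
  have h := (((hasDerivAt_pow 2 ρ).const_mul (2 * c⁻¹)).div
    ((hasDerivAt_pow 2 ρ).const_sub 1) hρ).const_add 1
  have h' : HasDerivAt (rOf c) _ ρ := h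
  rw [h'.deriv]
  field_simp
  push_cast
  ring

theorem g_eq_radialForm (hn : 1 ≤ n) {c : ℝ} (hc : 0 < c) {x : Cn n} (hx : ‖x‖ < 1) :
    g n c x = radialForm (gRe n c⁻¹ (‖x‖ ^ 2)) (gIm n c⁻¹ (‖x‖ ^ 2)) (gEuclid c⁻¹ (‖x‖ ^ 2)) x := by
  by_cases h0 : x = 0
  · subst h0
    rw [g, cohomOneMetric_zero (gRe n c⁻¹ (‖(0 : Cn n)‖ ^ 2)) (gIm n c⁻¹ (‖(0 : Cn n)‖ ^ 2))]
    congr 1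
    norm_num [gEuclid]
  · have hρ : 0 < ‖x‖ := norm_pos_iff.2 h0
    have h1 : 0 < 1 - ‖x‖ ^ 2 := by nlinarith
    set ρ := ‖x‖ with hρd
    -- In terms of `u` all coefficients become rational expressions in `u`, `ε`, `q` and powers of
    -- `2 + 2uε`.
    obtain ⟨u, hu⟩ : ∃ u, u = ρ ^ 2 / (1 - ρ ^ 2) := ⟨_, rfl⟩
    have hu0 : 0 < u := by rw [hu]; positivity
    have hr : rOf c ρ = 1 + 2 * u * c⁻¹ := by rw [rOf, hu]; ring
    have hw : 1 - ρ ^ 2 = (1 + u)⁻¹ := by rw [hu]; field_simp; ring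
    have ht : ρ ^ 2 = u / (1 + u) := by rw [hu]; field_simp; ring
    have hq := qFun_pos hn (inv_pos.2 hc).le hu0.le
    have hqV := qFun_eq hn c⁻¹ u
    have hsq : (1 + 2 * u * c⁻¹) ^ 2 - 1 = (2 * u * c⁻¹) * (2 + 2 * u * c⁻¹) := by ring
    have hα : alphaSq n c (rOf c ρ) * deriv (rOf c) ρ ^ 2
        = 8 * (2 + 2 * u * c⁻¹) ^ (n - 1) * (1 + u) ^ 3 / qFun n c⁻¹ u := by
      rw [deriv_rOf h1.ne', hw, div_pow, mul_pow, ht, alphaSq, hr, P_eq hn hc hu0.le, hsq,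
        mul_pow (2 * u * c⁻¹)]
      obtain ⟨m, rfl⟩ : ∃ m, n = m + 1 := ⟨n - 1, by omega⟩
      rw [Nat.add_sub_cancel, pow_succ _ m]
      generalize qFun (m + 1) c⁻¹ u = Q at *
      field_simp
      ring
    have hβ : betaSq n c (rOf c ρ) = 2 * u * qFun n c⁻¹ u / (2 + 2 * u * c⁻¹) ^ (n - 1) := by
      rw [betaSq, hr, P_eq hn hc hu0.le, hsq, mul_pow (2 * u * c⁻¹)]
      obtain ⟨m, rfl⟩ : ∃ m, n = m + 1 := ⟨n - 1, by omega⟩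
      rw [Nat.add_sub_cancel, pow_succ _ m]
      have hA : 0 < (2 * u * c⁻¹) ^ m := by positivity
      have hT : 0 < (2 + 2 * u * c⁻¹) ^ m := by positivity
      generalize qFun (m + 1) c⁻¹ u = Q at *
      generalize (2 * u * c⁻¹) ^ m = A at *
      generalize (2 + 2 * u * c⁻¹) ^ m = T at *
      field_simp
    have hγ : gammaSq c (rOf c ρ) = 2 * u * (2 + 2 * u * c⁻¹) := by
      rw [gammaSq, hr, hsq]
      field_simp
    have hm : (2 + 2 * u * c⁻¹) ^ n = (2 + 2 * u * c⁻¹) ^ (n - 1) * (2 + 2 * u * c⁻¹) := by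
      rw [← pow_succ, Nat.sub_add_cancel hn]
    have hS : 0 < 2 + 2 * u * c⁻¹ := by positivity
    rw [hm] at hqV
    rw [g, cohomOneMetric_eq_radialForm h0, ← hρd, hα, hβ, hγ]
    rw [gRe, gIm, gEuclid, ← hu, (by ring : ρ ^ 4 = ρ ^ 2 * ρ ^ 2), hw, ht]
    have hSn : 0 < (2 + 2 * u * c⁻¹) ^ (n - 1) := by positivity
    have hS2 : 2 * u * c⁻¹ = (2 + 2 * u * c⁻¹) - 2 := by ring
    generalize hq' : qFun n c⁻¹ u = Q at *
    generalize (2 + 2 * u * c⁻¹) ^ (n - 1) = T at *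
    generalize vFun n c⁻¹ u = V at *
    generalize c⁻¹ = ε at *
    congr 1
    -- With `S = 2 + 2uε`, both `q - Sⁿ = uV` and `4(1 + u)² - S² = 2u(1 - ε)(4 + 2u + 2uε)` contain
    -- the factor `u` that cancels the pole.
    · field_simp
      rw [hqV]
      ring
    · field_simp
      rw [hqV]
      ring
    · field_simp

/-! ### Smoothness of the coefficients -/

section Smoothness

variable {E : Type*} [NormedAddCommGroup E] [NormedSpace ℝ E] {ε t : E → ℝ} {a : E}

theorem contDiffAt_eval (p : Polynomial ℝ) {s : E → ℝ} (hs : ContDiffAt ℝ ∞ s a) :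
    ContDiffAt ℝ ∞ (fun y => p.eval (s y)) a := by
  have h : ContDiff ℝ ∞ fun x : ℝ => p.eval x := by
    simpa using p.contDiff_aeval (𝕜 := ℝ) (R := ℝ) ∞
  exact h.contDiffAt.comp a hs

theorem contDiffAt_vFun (n : ℕ) (hε : ContDiffAt ℝ ∞ ε a) (ht : ContDiffAt ℝ ∞ t a) :
    ContDiffAt ℝ ∞ (fun y => vFun n (ε y) (t y)) a := by
  have hs : ContDiffAt ℝ ∞ (fun y => 2 * t y * ε y) a := by fun_prop
  have h1 := contDiffAt_eval (tPoly n) hs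
  have h2 := contDiffAt_eval (rPoly n) hs
  unfold vFun
  fun_prop

theorem contDiffAt_qFun (n : ℕ) (hε : ContDiffAt ℝ ∞ ε a) (ht : ContDiffAt ℝ ∞ t a) :
    ContDiffAt ℝ ∞ (fun y => qFun n (ε y) (t y)) a := by
  have hs : ContDiffAt ℝ ∞ (fun y => 2 * t y * ε y) a := by fun_prop
  have h1 := contDiffAt_eval (rPoly (n - 1)) hs
  have h2 := contDiffAt_eval (rPoly n) hs
  unfold qFun
  fun_prop

theorem contDiffAt_div_one_sub (ht : ContDiffAt ℝ ∞ t a) (h1 : t a < 1) :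
    ContDiffAt ℝ ∞ (fun y => t y / (1 - t y)) a :=
  ht.div (contDiffAt_const.sub ht) (sub_pos.2 h1).ne'

theorem contDiffAt_gRe (hn : 1 ≤ n) (hε : ContDiffAt ℝ ∞ ε a) (ht : ContDiffAt ℝ ∞ t a)
    (hε0 : 0 ≤ ε a) (h0 : 0 ≤ t a) (h1 : t a < 1) :
    ContDiffAt ℝ ∞ (fun y => gRe n (ε y) (t y)) a := by
  have hu := contDiffAt_div_one_sub ht h1
  have hV := contDiffAt_vFun n hε hu
  have hQ := contDiffAt_qFun n hε hu
  have h1' : 0 < 1 - t a := sub_pos.2 h1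
  have hq := qFun_pos hn hε0 (div_nonneg h0 h1'.le)
  unfold gRe
  refine ContDiffAt.div ?_ ?_ (by positivity) <;> fun_prop

theorem contDiffAt_gIm (n : ℕ) (hε : ContDiffAt ℝ ∞ ε a) (ht : ContDiffAt ℝ ∞ t a)
    (hε0 : 0 ≤ ε a) (h0 : 0 ≤ t a) (h1 : t a < 1) :
    ContDiffAt ℝ ∞ (fun y => gIm n (ε y) (t y)) a := by
  have hu := contDiffAt_div_one_sub ht h1
  have hV := contDiffAt_vFun n hε hu
  have h1' : 0 < 1 - t a := sub_pos.2 h1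
  unfold gIm
  refine ContDiffAt.div ?_ ?_ (by positivity) <;> fun_prop

theorem contDiffAt_gEuclid (hε : ContDiffAt ℝ ∞ ε a) (ht : ContDiffAt ℝ ∞ t a) (h1 : t a < 1) :
    ContDiffAt ℝ ∞ (fun y => gEuclid (ε y) (t y)) a := by
  have hu := contDiffAt_div_one_sub ht h1
  unfold gEuclid
  refine ContDiffAt.div ?_ ?_ (sub_pos.2 h1).ne' <;> fun_prop

end Smoothness

theorem contDiffOn_g (hn : 1 ≤ n) {c : ℝ} (hc : 0 < c) : ContDiffOn ℝ ∞ (g n c) (ball 0 1) := by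
  have h : ContDiffOn ℝ ∞ (fun x => radialForm (gRe n c⁻¹ (‖x‖ ^ 2)) (gIm n c⁻¹ (‖x‖ ^ 2))
      (gEuclid c⁻¹ (‖x‖ ^ 2)) x) (ball (0 : Cn n) 1) := by
    intro x hx
    have hx1 := mem_ball_zero_iff.1 hx
    have ht : ContDiffAt ℝ ∞ (fun y : Cn n => ‖y‖ ^ 2) x := (contDiff_norm_sq ℝ).contDiffAt
    have h1 : ‖x‖ ^ 2 < 1 := by nlinarith [norm_nonneg x]
    have h0 := sq_nonneg ‖x‖
    have hc' := (inv_pos.2 hc).le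
    exact (contDiffAt_radialForm (contDiffAt_gRe hn contDiffAt_const ht hc' h0 h1)
      (contDiffAt_gIm n contDiffAt_const ht hc' h0 h1)
      (contDiffAt_gEuclid contDiffAt_const ht h1) contDiffAt_id).contDiffWithinAt
  exact h.congr fun x hx => g_eq_radialForm hn hc (mem_ball_zero_iff.1 hx)

/-! ### The pulled-back family and its value at `ε = 0` -/

/-- The pullback of `g` by `dilate k`, as a function of `ε = c⁻¹` and the point. -/
def pullbackFamily (n : ℕ) (k : ℝ) (y : ℝ × Cn n) : BilinForm n :=
  let D := k + (1 - k) * ‖y.2‖ ^ 2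
  radialForm
    (gRe n y.1 (‖y.2‖ ^ 2 / D) * k ^ 2 / D ^ 4
      + gEuclid y.1 (‖y.2‖ ^ 2 / D) / D * ((1 - k) ^ 2 * ‖y.2‖ ^ 2 / D ^ 2 - 2 * (1 - k) / D))
    (gIm n y.1 (‖y.2‖ ^ 2 / D) / D ^ 2) (gEuclid y.1 (‖y.2‖ ^ 2 / D) / D) y.2

theorem pullback_g_eq (hn : 1 ≤ n) {k c : ℝ} (hk : 0 < k) (hc : 0 < c) {x : Cn n} (hx : ‖x‖ < 1) :
    pullback (dilate k) (g n c) x = pullbackFamily n k (c⁻¹, x) := by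
  rw [pullback_dilate hk hx.le rfl (g_eq_radialForm hn hc (norm_dilate_lt hk hx)),
    norm_dilate_sq hk hx.le]
  rfl

/-- The value `ε = 0` is included: all denominators, `q` among them, are still positive there. -/
theorem contDiffAt_pullbackFamily (hn : 1 ≤ n) {k ε : ℝ} (hk : 0 < k) (hε : 0 ≤ ε) {x : Cn n}
    (hx : ‖x‖ < 1) : ContDiffAt ℝ ∞ (pullbackFamily n k) (ε, x) := by
  have hD := dilate_den_pos hk hx.le
  have ht : ContDiffAt ℝ ∞ (fun y : ℝ × Cn n => ‖y.2‖ ^ 2) (ε, x) :=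
    (contDiff_snd.norm_sq ℝ).contDiffAt
  have hDc : ContDiffAt ℝ ∞ (fun y : ℝ × Cn n => k + (1 - k) * ‖y.2‖ ^ 2) (ε, x) :=
    contDiffAt_const.add (contDiffAt_const.mul ht)
  have hτ := ht.div hDc hD.ne'
  have h0 : 0 ≤ ‖x‖ ^ 2 / (k + (1 - k) * ‖x‖ ^ 2) := div_nonneg (sq_nonneg _) hD.le
  have h1 : ‖x‖ ^ 2 / (k + (1 - k) * ‖x‖ ^ 2) < 1 := by
    rw [← norm_dilate_sq hk hx.le]
    nlinarith [norm_dilate_lt hk hx, norm_nonneg (dilate k x)]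
  have hR := contDiffAt_gRe hn (contDiffAt_fst (p := (ε, x))) hτ hε h0 h1
  have hI := contDiffAt_gIm n (contDiffAt_fst (p := (ε, x))) hτ hε h0 h1
  have hE := contDiffAt_gEuclid (contDiffAt_fst (p := (ε, x))) hτ h1
  refine contDiffAt_radialForm (((hR.mul contDiffAt_const).div (hDc.pow 4) (by positivity)).add
    ((hE.div hDc hD.ne').mul (((contDiffAt_const.mul ht).div (hDc.pow 2) (by positivity)).sub
      (contDiffAt_const.div hDc hD.ne')))) (hI.div (hDc.pow 2) (by positivity)) (hE.div hDc hD.ne')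
    contDiffAt_snd

/-- The scaling factor of `|x|² / (1 - |x|²)` for which the limit is complex hyperbolic. -/
def limitScale (n : ℕ) : ℝ := 2 * (2 * n - 1) / (n + 1)

theorem limitScale_pos (hn : 1 ≤ n) : 0 < limitScale n := by
  have hn' : (1 : ℝ) ≤ n := by exact_mod_cast hn
  have h3 : (0 : ℝ) < 2 * n - 1 := by linarith
  unfold limitScale
  positivity

/-- At `ε = 0` the quotient is independent of `u`, so `q(0, u)` is affine in `u`; this is why a
dilation suffices. -/
theorem vFun_zero (n : ℕ) (u : ℝ) : vFun n 0 u = 2 ^ n * limitScale n := by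
  rw [vFun, mul_zero, mul_zero, zero_mul, zero_add, eval_zero_rPoly, limitScale]
  ring

theorem pullbackFamily_zero (hn : 1 ≤ n) {x : Cn n} (hx : ‖x‖ < 1) :
    pullbackFamily n (limitScale n) (0, x) = (((n : ℝ) + 1) / (2 * (n : ℝ) - 1)) • gCH n x := by
  have hk := limitScale_pos hn
  have hD := dilate_den_pos hk hx.le
  have hlam : ((n : ℝ) + 1) / (2 * (n : ℝ) - 1) = 2 / limitScale n := by
    rw [limitScale]
    have hn' : (1 : ℝ) ≤ n := by exact_mod_cast hn
    have h3 : (0 : ℝ) < 2 * n - 1 := by linarith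
    field_simp
  have ht : 0 < 1 - ‖x‖ ^ 2 := by nlinarith [norm_nonneg x]
  rw [gCH_eq_radialForm hx, smul_radialForm, hlam, pullbackFamily]
  dsimp only
  have hQ := qFun_eq hn 0
  have hp : (2 : ℝ) ^ n = 2 ^ (n - 1) * 2 := by rw [← pow_succ, Nat.sub_add_cancel hn]
  simp only [vFun_zero, mul_zero, add_zero, hp] at hQ
  simp only [gRe, gIm, gEuclid, vFun_zero, hQ, mul_zero, add_zero, sub_zero, hp]
  have ht0 := sq_nonneg ‖x‖
  have hT : (0 : ℝ) < 2 ^ (n - 1) := by positivity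
  generalize (2 : ℝ) ^ (n - 1) = T at *
  generalize limitScale n = k at *
  obtain ⟨D, hDd⟩ : ∃ D, D = k + (1 - k) * ‖x‖ ^ 2 := ⟨_, rfl⟩
  rw [← hDd] at hD ⊢
  generalize ‖x‖ ^ 2 = t at *
  have h1 : 1 - t / D = k * (1 - t) / D := by
    field_simp
    linear_combination hDd
  have hu : t / D / (k * (1 - t) / D) = t / (k * (1 - t)) := by
    field_simp
  -- This is `q(0, u/k) = 2ⁿ(1 + u)`, the identity that dictates the choice of `k`.
  have hq : T * 2 + t / (k * (1 - t)) * (T * 2 * k) = T * 2 / (1 - t) := by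
    field_simp
    ring
  rw [h1, hu, hq]
  congr 1
  · field_simp
    rw [hDd]
    ring
  · field_simp
  · field_simp

end BergerBall

end

theorem theorem2 (n : ℕ) (hn : 2 ≤ n) :
    (∀ c : ℝ, 0 < c → ContDiffOn ℝ ∞ (BergerBall.g n c) (Metric.ball 0 1)) ∧
    ∃ ψ : ℝ → BergerBall.Cn n → BergerBall.Cn n,
      (∀ c : ℝ, 0 < c → BergerBall.IsEquivariantDiffeo (ψ c)) ∧
      BergerBall.SmoothlyConvergesOn
        (fun c => BergerBall.pullback (ψ c) (BergerBall.g n c))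
        (fun x => (((n : ℝ) + 1) / (2 * (n : ℝ) - 1)) • BergerBall.gCH n x)
        (Metric.ball 0 1) := by
  have hn1 : 1 ≤ n := by omega
  set k := BergerBall.limitScale n with hkd
  have hk : 0 < k := BergerBall.limitScale_pos hn1
  have hfam : ∀ {ε : ℝ}, 0 ≤ ε →
      ContDiffOn ℝ ∞ (fun x => BergerBall.pullbackFamily n k (ε, x)) (ball 0 1) := by
    intro ε hε x hx
    exact ((BergerBall.contDiffAt_pullbackFamily hn1 hk hε (mem_ball_zero_iff.1 hx)).comp x
      (contDiffAt_const.prodMk contDiffAt_id)).contDiffWithinAt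
  have hlim : Set.EqOn (fun x => (((n : ℝ) + 1) / (2 * (n : ℝ) - 1)) • BergerBall.gCH n x)
      (fun x => BergerBall.pullbackFamily n k (0, x)) (ball 0 1) := fun x hx =>
    (BergerBall.pullbackFamily_zero hn1 (mem_ball_zero_iff.1 hx)).symm
  have hpull : ∀ {c : ℝ}, 0 < c →
      Set.EqOn (BergerBall.pullback (BergerBall.dilate k) (BergerBall.g n c))
        (fun x => BergerBall.pullbackFamily n k (c⁻¹, x)) (ball 0 1) := fun hc x hx =>
    BergerBall.pullback_g_eq hn1 hk hc (mem_ball_zero_iff.1 hx)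
  refine ⟨fun c hc => BergerBall.contDiffOn_g hn1 hc, fun _ => BergerBall.dilate k,
    fun _ _ => BergerBall.isEquivariantDiffeo_dilate hk, ?_, ?_, ?_⟩
  · filter_upwards [eventually_gt_atTop 0] with c hc
    exact (hfam (inv_pos.2 hc).le).congr (hpull hc)
  · exact (hfam le_rfl).congr hlim
  · intro K hKU hK m
    -- Equality on the open ball gives equality of germs at points of `K`, hence of all iterated
    -- derivatives there.
    have hcongr : ∀ {h h' : BergerBall.Cn n → BergerBall.BilinForm n},
        Set.EqOn h h' (ball 0 1) → Set.EqOn (iteratedFDeriv ℝ m h) (iteratedFDeriv ℝ m h') K :=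
      fun hh x hx => ((hh.eventuallyEq_of_mem (isOpen_ball.mem_nhds (hKU hx))).iteratedFDeriv ℝ
        m).eq_of_nhds
    have hconv := BergerBall.tendstoUniformlyOn_iteratedFDeriv_slice hK (fun x hx =>
      BergerBall.contDiffAt_pullbackFamily hn1 hk le_rfl (mem_ball_zero_iff.1 (hKU hx))) m
    have hconv' : TendstoUniformlyOn
        (fun c : ℝ => iteratedFDeriv ℝ m fun x => BergerBall.pullbackFamily n k (c⁻¹, x))
        (iteratedFDeriv ℝ m fun x => BergerBall.pullbackFamily n k (0, x)) atTop K :=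
      fun U hU => tendsto_inv_atTop_zero.eventually (hconv U hU)
    refine (hconv'.congr ?_).congr_right (hcongr hlim).symm
    filter_upwards [eventually_gt_atTop 0] with c hc
    exact (hcongr (hpull hc)).symm
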